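/- **Setting.** Let $X$ be a smooth complex projective variety with a fixed ample line bundle $L$, and $S\subset X$ a smooth connected (nonempty, reduced) divisor with ideal sheaf $I_S$. Let $\Lambda=\mathcal D_X[\log S]$ be the sheaf of differential operators generated by $\mathcal O_X$ and the vector fields preserving $I_S$. A *logarithmic module* is a $\Lambda$-module that is coherent over $\mathcal O_X$; it is *semistable* if it is pure dimensional and $p(F',n)/r(F')\le p(F,n)/r(F)$ for $n\gg0$ and every nonzero $\mathcal O_X$-coherent $\Lambda$-submodule $F'\subset F$, where $p$ is the Hilbert polynomial with respect to $L$ and $r$ the rank. The polynomial $p(F,n)/r(F)$ is the *normalized Hilbert polynomial*. A *pre-$\mathcal D$-module* $(E_0,E_1,s,t)$ consists of a logarithmic module $E_0$ that is torsion-free over $\mathcal O_X$, a logarithmic module $E_1$ with $I_SE_1=0$, and $\Lambda$-linear maps $s:E_1\to E_0|S=E_0/I_SE_0$ and $t:E_0|S\to E_1$ such that $st$ and $ts$ are the endomorphisms $\theta$ induced by any Eulerian vector field ($x\,\partial/\partial x$, for a local equation $x$ of $S$). A *reduced module* is a tuple ${\bf E}=(E_0,E_1,u)$ with $u=s\otimes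 t\in \mathrm{Hom}_\Lambda(E_1,E_0|S)\otimes_{\mathbb C}\mathrm{Hom}_\Lambda(E_0|S,E_1)$ for some pre-$\mathcal D$-module $(E_0,E_1,s,t)$; it is *semistable* if $E_0$ and $E_1$ are. Below, write $u=s\otimes t$, with $s=0$ and $t=0$ if $u=0$ (if $u\neq0$, the choice of $s,t$ does not matter). A *subbundle* of $E_0$ (of $E_1$) means a $\Lambda$-submodule that is a vector subbundle of the vector bundle $E_0$ on $X$ (of the vector bundle $E_1$ on $S$). A *special filtration* of ${\bf E}$ is a pair of increasing filtrations $(E_i)_p$, $p\in\mathbb Z$, of $E_i$ ($i=0,1$) by subbundles, with $(E_i)_p=0$ for $p\ll0$ and $(E_i)_p=E_i$ for $p\gg0$, such that $s((E_1)_p)\subset (E_0)_p|S$ and $t((E_0)_p|S)\subset (E_1)_p$ for all $p$, and such that each nonzero $(E_i)_p$ has the same normalized Hilbert polynomial as $E_i$. It is *nontrivial* if $0\ne(E_i)_p\ne E_i$ for some $p$ and for $i=0$ or $i=1$. A semistable reduced module is *stable* if it has no nontrivial special filtration. Given filtrations $0=F_0(E_i)\subset F_1(E_i)\subset\cdots\subset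 F_{\ell_i}(E_i)=E_i$ ($i=0,1$) by subbundles, let $k(j)$ be the smallest $k$ with $t(F_j(E_0)|S)\subset F_k(E_1)$ and $j(k)$ the smallest $j$ with $s(F_k(E_1))\subset F_j(E_0)|S$, for $0\le j\le \ell_0$ and $0\le k\le\ell_1$. Put $$G_t=\{(j,k)\mid k\le k(j)\},\qquad G_s=\{(j,k)\mid j\le j(k)\}.$$ A point $(j,k(j))$ is a jump point of $G_t$ if $j=0$ or $k(j-1)<k(j)$, and a point $(j(k),k)$ is a jump point of $G_s$ if $k=0$ or $j(k-1)<j(k)$. One says that $u$ is *compatible* with the filtrations if every point of $G_s\cap G_t$ is a jump point of both $G_s$ and $G_t$. **Proposition.** Let ${\bf E}=(E_0,E_1,u)$ be a semistable reduced module. The following are equivalent: 1. ${\bf E}$ is not stable; 2. there are integers $\ell_0,\ell_1\ge0$ and filtrations $0=F_0(E_i)\subsetneq F_1(E_i)\subsetneq\cdots\subsetneq F_{\ell_i}(E_i)=E_i$ ($i=0,1$) by subbundles, all of whose nonzero steps have the same normalized Hilbert polynomial as $E_i$, such that $0\neq F_j(E_i)\neq E_i$ for some $j$ and for $i=0$ or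 $i=1$, and such that $u$ is compatible with these filtrations. -/

import Mathlib

open CategoryTheory AlgebraicGeometry Limits Filter
open scoped TensorProduct

noncomputable section

namespace PreDMod

/-! ### Twists, ampleness, Hilbert polynomials -/

/-- The tensor product of two sheaves of modules: the sheafification of the presheaf
`U ↦ Γ(M, U) ⊗ Γ(N, U)`. -/
def tensorSheaf {X : Scheme.{0}} (M N : X.Modules) : X.Modules :=
  (PresheafOfModules.sheafification (𝟙 X.ringCatSheaf.obj)).obj
    (MonoidalCategoryStruct.tensorObj
      (C := PresheafOfModules.{0} (X.presheaf ⋙ forget₂ CommRingCat RingCat)) M.val N.val)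

/-- `M ⊗ L^{⊗ n}`. -/
def twist {X : Scheme.{0}} (L M : X.Modules) : ℕ → X.Modules
  | 0 => M
  | n + 1 => tensorSheaf (twist L M n) L

/-- Coherence; all schemes below are noetherian, so it is the same as finite presentation. -/
def IsCoherent {X : Scheme.{0}} (M : X.Modules) : Prop :=
  SheafOfModules.IsFinitePresentation.{0} (R := X.ringCatSheaf) M

/-- Locally free sheaves of modules. -/
def IsLocFree {X : Scheme.{0}} (M : X.Modules) : Prop :=
  SheafOfModules.IsLocallyFree.{0} (R := X.ringCatSheaf) M

/-- Invertible sheaves: locally isomorphic to the structure sheaf. -/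
def IsLineBundle {X : Scheme.{0}} (L : X.Modules) : Prop :=
  ∀ x : X, ∃ U : X.Opens, x ∈ U ∧
    Nonempty (L.restrict U.ι ≅ SheafOfModules.unit (U : Scheme.{0}).ringCatSheaf)

/-- An invertible sheaf `L` is ample if for each coherent `M` the sheaves `M ⊗ L^{⊗ n}`, `n ≫ 0`,
are generated by their global sections. -/
def IsAmple {X : Scheme.{0}} (L : X.Modules) : Prop :=
  IsLineBundle L ∧ ∀ M : X.Modules, IsCoherent M → ∀ᶠ n in atTop,
    Nonempty (SheafOfModules.GeneratingSections.{0} (R := X.ringCatSheaf) (twist L M n))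

/-- The ring homomorphism `ℂ → Γ(X, U)` of a complex scheme. -/
def scalars {X : Scheme.{0}} (str : X ⟶ Spec (CommRingCat.of ℂ)) (U : X.Opens) : ℂ →+* Γ(X, U) :=
  (str.appLE ⊤ U le_top).hom.comp (Scheme.ΓSpecIso (CommRingCat.of ℂ)).inv.hom

/-- The complex dimension of the space of global sections of `M`. -/
def h0 {X : Scheme.{0}} (str : X ⟶ Spec (CommRingCat.of ℂ)) (M : X.Modules) : ℕ :=
  letI : Module ℂ Γ(M, ⊤) := Module.compHom _ (scalars str ⊤)
  Module.finrank ℂ Γ(M, ⊤)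

/-- `p` is the Hilbert polynomial of `M` with respect to `L`:
`p(n) = dim H⁰(X, M ⊗ L^{⊗ n})` for `n ≫ 0`. -/
def IsHilbertPoly {X : Scheme.{0}} (str : X ⟶ Spec (CommRingCat.of ℂ)) (L M : X.Modules)
    (p : Polynomial ℚ) : Prop :=
  ∀ᶠ n : ℕ in atTop, (h0 str (twist L M n) : ℚ) = p.eval (n : ℚ)

open Classical in
/-- The Hilbert polynomial of `M`. (It exists for `M` coherent, `X` proper and `L` ample.) -/
def hilbertPoly {X : Scheme.{0}} (str : X ⟶ Spec (CommRingCat.of ℂ)) (L M : X.Modules) :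
    Polynomial ℚ :=
  if h : ∃ p, IsHilbertPoly str L M p then h.choose else 0

/-- The rank `r` of a nonzero coherent sheaf, read off from the leading term `r n ^ d / d !` of its
Hilbert polynomial. -/
def rankOf {X : Scheme.{0}} (str : X ⟶ Spec (CommRingCat.of ℂ)) (L M : X.Modules) : ℚ :=
  (hilbertPoly str L M).leadingCoeff * ((hilbertPoly str L M).natDegree.factorial : ℚ)

/-- The normalized Hilbert polynomial `p / r`. -/
def normHilbertPoly {X : Scheme.{0}} (str : X ⟶ Spec (CommRingCat.of ℂ)) (L M : X.Modules) :
    Polynomial ℚ :=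
  Polynomial.C (rankOf str L M)⁻¹ * hilbertPoly str L M

/-- The dimension of the support of a sheaf of modules. -/
def suppDim {X : Scheme.{0}} (M : X.Modules) : WithBot ℕ∞ :=
  topologicalKrullDim {x : X | Nontrivial (TopCat.Presheaf.stalk (C := Ab) M.presheaf x : Ab)}

/-- Pure dimensional: all nonzero coherent subsheaves have a support of the same dimension. -/
def IsPure {X : Scheme.{0}} (M : X.Modules) : Prop :=
  ∀ F : Subobject M, IsCoherent (F : X.Modules) → F ≠ ⊥ → suppDim (F : X.Modules) = suppDim M

/-! ### The pair `(X, S)` and logarithmic modules -/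

/-- A smooth complex projective variety `X` with a fixed ample line bundle `L` (a proper scheme over
`ℂ` with an ample line bundle is projective), and a smooth connected divisor `S ⊂ X`, given by its
sheaf of ideals. -/
structure LogPair where
  X : Scheme.{0}
  str : X ⟶ Spec (CommRingCat.of ℂ)
  isIntegral : IsIntegral X
  smooth : Smooth str
  proper : IsProper str
  L : X.Modules
  ample : IsAmple L
  S : X.IdealSheafData
  divisor : ∀ x : X, ∃ U : X.affineOpens, x ∈ U.1 ∧
    ∃ f : Γ(X, U), f ≠ 0 ∧ S.ideal U = Ideal.span {f}
  smooth_S : Smooth (S.subschemeι ≫ str)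
  connected_S : ConnectedSpace S.subscheme

variable (P : LogPair)

instance (U : P.X.Opens) : Algebra ℂ Γ(P.X, U) := (scalars P.str U).toAlgebra

instance (E : P.X.Modules) (U : P.X.Opens) : Module ℂ Γ(E, U) :=
  Module.compHom _ (scalars P.str U)

instance (E : P.X.Modules) (U : P.X.Opens) : IsScalarTower ℂ Γ(P.X, U) Γ(E, U) :=
  ⟨fun a b m => by
    rw [Algebra.smul_def, mul_smul]; rfl⟩

/-- Restriction of functions. -/
def resO {U V : P.X.affineOpens} (h : V ≤ U) : Γ(P.X, U) →+* Γ(P.X, V) :=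
  (P.X.presheaf.map (homOfLE (show V.1 ≤ U.1 from h)).op).hom

lemma resO_algebraMap {U V : P.X.affineOpens} (h : V ≤ U) (c : ℂ) :
    resO P h (algebraMap ℂ Γ(P.X, U) c) = algebraMap ℂ Γ(P.X, V) c := by
  change ((P.str.appLE ⊤ U.1 le_top ≫
    P.X.presheaf.map (homOfLE (show V.1 ≤ U.1 from h)).op).hom _) = _
  exact congrArg (fun φ => φ.hom ((Scheme.ΓSpecIso (CommRingCat.of ℂ)).inv.hom c))
    (Scheme.Hom.appLE_map P.str (U := ⊤) (V := U.1) le_top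
      (homOfLE (show V.1 ≤ U.1 from h)).op)

/-- Multiplication by a function, as an operator on functions. -/
def mulOp (U : P.X.affineOpens) (f : Γ(P.X, U)) : Module.End ℂ Γ(P.X, U) :=
  LinearMap.mulLeft ℂ f

/-- Sections over `U` of `T_X[log S]`: the vector fields that preserve the ideal of `S`. -/
def IsLogField (U : P.X.affineOpens) (δ : Derivation ℂ Γ(P.X, U) Γ(P.X, U)) : Prop :=
  ∀ f ∈ P.S.ideal U, δ f ∈ P.S.ideal U

/-- Sections over the affine open `U` of `D_X[log S]`: the algebra of operators on functions that is
generated by the functions and by `T_X[log S]`. -/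
def logDiff (U : P.X.affineOpens) : Subalgebra ℂ (Module.End ℂ Γ(P.X, U)) :=
  Algebra.adjoin ℂ (Set.range (mulOp P U) ∪ {D | ∃ δ, IsLogField P U δ ∧ D = δ.toLinearMap})

/-- A function, as a section of `D_X[log S]`. -/
def fnOp (U : P.X.affineOpens) (f : Γ(P.X, U)) : logDiff P U :=
  ⟨mulOp P U f, Algebra.subset_adjoin (Or.inl ⟨f, rfl⟩)⟩

/-- A logarithmic vector field, as a section of `D_X[log S]`. -/
def fieldOp (U : P.X.affineOpens) (δ : Derivation ℂ Γ(P.X, U) Γ(P.X, U))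
    (hδ : IsLogField P U δ) : logDiff P U :=
  ⟨δ.toLinearMap, Algebra.subset_adjoin (Or.inr ⟨δ, hδ, rfl⟩)⟩

/-- `Q` is the restriction to `V` of the operator `D` on `U`. -/
def IsRes {U V : P.X.affineOpens} (h : V ≤ U) (D : logDiff P U) (Q : logDiff P V) : Prop :=
  ∀ f : Γ(P.X, U), resO P h (D.1 f) = Q.1 (resO P h f)

/-- A `D_X[log S]`-module, given by its modules of sections over the affine opens. -/
structure DMod where
  obj : P.X.affineOpens → Type
  [grp : ∀ U : P.X.affineOpens, AddCommGroup (obj U)]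
  [mod : ∀ U : P.X.affineOpens, Module Γ(P.X, U) (obj U)]
  [modC : ∀ U : P.X.affineOpens, Module ℂ (obj U)]
  [tower : ∀ U : P.X.affineOpens, IsScalarTower ℂ Γ(P.X, U) (obj U)]
  res : ∀ {U V : P.X.affineOpens}, V ≤ U → obj U →+ obj V
  res_smul : ∀ {U V : P.X.affineOpens} (h : V ≤ U) (f : Γ(P.X, U)) (m : obj U),
    res h (f • m) = resO P h f • res h m
  act : ∀ U : P.X.affineOpens, logDiff P U →+* AddMonoid.End (obj U)
  act_fn : ∀ (U : P.X.affineOpens) (f : Γ(P.X, U)) (m : obj U), act U (fnOp P U f) m = f • m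
  act_res : ∀ {U V : P.X.affineOpens} (h : V ≤ U) (D : logDiff P U) (Q : logDiff P V),
    IsRes P h D Q → ∀ m, res h (act U D m) = act V Q (res h m)

attribute [instance] DMod.grp DMod.mod DMod.modC DMod.tower

lemma DMod.res_smulC (M : DMod P) {U V : P.X.affineOpens} (h : V ≤ U) (c : ℂ) (m : M.obj U) :
    M.res h (c • m) = c • M.res h m := by
  rw [← algebraMap_smul Γ(P.X, U) c m, M.res_smul, resO_algebraMap, algebraMap_smul]

lemma DMod.act_smulC (M : DMod P) (U : P.X.affineOpens) (D : logDiff P U) (c : ℂ) (m : M.obj U) :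
    M.act U D (c • m) = c • M.act U D m := by
  have key : D * fnOp P U (algebraMap ℂ _ c) = fnOp P U (algebraMap ℂ _ c) * D := by
    apply Subtype.ext
    apply LinearMap.ext
    intro g
    change D.1 (algebraMap ℂ _ c * g) = algebraMap ℂ _ c * D.1 g
    rw [← Algebra.smul_def, ← Algebra.smul_def, map_smul]
  have := congrArg (fun D => M.act U D m) key
  simp only [map_mul] at this
  rw [← algebraMap_smul Γ(P.X, U) c m, ← algebraMap_smul Γ(P.X, U) c (M.act U D m),
    ← M.act_fn, ← M.act_fn]
  exact this

/-- A logarithmic module on `(X, S)`: a coherent sheaf with an action of `D_X[log S]` that extends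
its module structure. -/
structure LogModule where
  sheaf : P.X.Modules
  coherent : IsCoherent sheaf
  act : ∀ U : P.X.affineOpens, logDiff P U →+* AddMonoid.End Γ(sheaf, U)
  act_fn : ∀ (U : P.X.affineOpens) (f : Γ(P.X, U)) (m : Γ(sheaf, U)), act U (fnOp P U f) m = f • m
  act_res : ∀ {U V : P.X.affineOpens} (h : V ≤ U) (D : logDiff P U) (Q : logDiff P V),
    IsRes P h D Q → ∀ m : Γ(sheaf, U),
      (sheaf.presheaf.map (homOfLE (show V.1 ≤ U.1 from h)).op).hom (act U D m) =
        act V Q ((sheaf.presheaf.map (homOfLE (show V.1 ≤ U.1 from h)).op).hom m)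

variable {P}

namespace LogModule

variable (E : LogModule P)

/-- Restriction of sections. -/
def resSec {U V : P.X.affineOpens} (h : V ≤ U) : Γ(E.sheaf, U) →+ Γ(E.sheaf, V) :=
  (E.sheaf.presheaf.map (homOfLE (show V.1 ≤ U.1 from h)).op).hom

lemma resSec_smul {U V : P.X.affineOpens} (h : V ≤ U) (f : Γ(P.X, U)) (m : Γ(E.sheaf, U)) :
    E.resSec h (f • m) = resO P h f • E.resSec h m :=
  Scheme.Modules.map_smul E.sheaf _ f m

/-- The `D_X[log S]`-module of sections of `E` over the affine opens. -/
def toDMod : DMod P where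
  obj U := Γ(E.sheaf, U)
  res h := E.resSec h
  res_smul h f m := E.resSec_smul h f m
  act := E.act
  act_fn := E.act_fn
  act_res := E.act_res

/-- The sections of `I_S E` over an affine open. -/
def idealSub (U : P.X.affineOpens) : Submodule Γ(P.X, U) Γ(E.sheaf, U) :=
  P.S.ideal U • ⊤

lemma res_mem {U V : P.X.affineOpens} (h : V ≤ U) (m : Γ(E.sheaf, U)) (hm : m ∈ E.idealSub U) :
    E.resSec h m ∈ E.idealSub V := by
  refine Submodule.smul_induction_on hm (fun r hr n _ => ?_) (fun x y hx hy => ?_)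
  · rw [resSec_smul]
    exact Submodule.smul_mem_smul (P.S.ideal_le_comap_ideal h hr) trivial
  · rw [map_add]; exact add_mem hx hy

lemma act_field_smul (U : P.X.affineOpens) (δ : Derivation ℂ Γ(P.X, U) Γ(P.X, U))
    (hδ : IsLogField P U δ) (f : Γ(P.X, U)) (m : Γ(E.sheaf, U)) :
    E.act U (fieldOp P U δ hδ) (f • m) = f • E.act U (fieldOp P U δ hδ) m + δ f • m := by
  have key : fieldOp P U δ hδ * fnOp P U f
      = fnOp P U f * fieldOp P U δ hδ + fnOp P U (δ f) := by
    apply Subtype.ext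
    apply LinearMap.ext
    intro g
    change δ (f * g) = f * δ g + δ f * g
    rw [Derivation.leibniz, smul_eq_mul, smul_eq_mul, mul_comm g]
  have := congrArg (fun D => E.act U D m) key
  simp only [map_mul, map_add] at this
  rw [← E.act_fn U f m, ← E.act_fn U f, ← E.act_fn U (δ f)]
  exact this

lemma act_mem (U : P.X.affineOpens) (D : logDiff P U) (m : Γ(E.sheaf, U))
    (hm : m ∈ E.idealSub U) : E.act U D m ∈ E.idealSub U := by
  obtain ⟨D, hD⟩ := D
  induction hD using Algebra.adjoin_induction generalizing m with
  | mem x hx =>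
    rcases hx with ⟨f, rfl⟩ | ⟨δ, hδ, rfl⟩
    · change E.act U (fnOp P U f) m ∈ _
      rw [E.act_fn]; exact Submodule.smul_mem _ _ hm
    · change E.act U (fieldOp P U δ hδ) m ∈ _
      refine Submodule.smul_induction_on hm (fun r hr n _ => ?_) (fun x y hx hy => ?_)
      · rw [act_field_smul]
        exact add_mem (Submodule.smul_mem_smul hr trivial)
          (Submodule.smul_mem_smul (hδ r hr) trivial)
      · rw [map_add]; exact add_mem hx hy
  | algebraMap r =>
    have : (⟨algebraMap ℂ _ r, Subalgebra.algebraMap_mem _ r⟩ : logDiff P U)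
        = fnOp P U (algebraMap ℂ _ r) := by
      apply Subtype.ext
      apply LinearMap.ext
      intro g
      change r • g = algebraMap ℂ _ r * g
      rw [Algebra.smul_def]
    change E.act U ⟨algebraMap ℂ _ r, _⟩ m ∈ _
    rw [this, E.act_fn]; exact Submodule.smul_mem _ _ hm
  | add x y hx hy ihx ihy =>
    have : E.act U ⟨x + y, add_mem hx hy⟩ m = E.act U ⟨x, hx⟩ m + E.act U ⟨y, hy⟩ m := by
      have h2 : (⟨x + y, add_mem hx hy⟩ : logDiff P U) = ⟨x, hx⟩ + ⟨y, hy⟩ := rfl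
      rw [h2, map_add]; rfl
    rw [this]; exact add_mem (ihx m hm) (ihy m hm)
  | mul x y hx hy ihx ihy =>
    have : E.act U ⟨x * y, mul_mem hx hy⟩ m = E.act U ⟨x, hx⟩ (E.act U ⟨y, hy⟩ m) := by
      have h2 : (⟨x * y, mul_mem hx hy⟩ : logDiff P U) = ⟨x, hx⟩ * ⟨y, hy⟩ := rfl
      rw [h2, map_mul]; rfl
    rw [this]; exact ihx _ (ihy m hm)

/-- An operator of `D_X[log S]` acting on `E / I_S E`. -/
def quotAct (U : P.X.affineOpens) (D : logDiff P U) :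
    AddMonoid.End (Γ(E.sheaf, U) ⧸ E.idealSub U) :=
  QuotientAddGroup.map (E.idealSub U).toAddSubgroup (E.idealSub U).toAddSubgroup (E.act U D)
    (fun m hm => E.act_mem U D m hm)

/-- The action of `D_X[log S]` on `E / I_S E`. -/
def quotActHom (U : P.X.affineOpens) :
    logDiff P U →+* AddMonoid.End (Γ(E.sheaf, U) ⧸ E.idealSub U) where
  toFun := E.quotAct U
  map_one' := by
    refine AddMonoidHom.ext fun q => ?_
    obtain ⟨m, rfl⟩ := Submodule.Quotient.mk_surjective _ q
    exact congrArg (fun φ : AddMonoid.End _ => (E.idealSub U).mkQ (φ m)) (map_one (E.act U))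
  map_zero' := by
    refine AddMonoidHom.ext fun q => ?_
    obtain ⟨m, rfl⟩ := Submodule.Quotient.mk_surjective _ q
    exact congrArg (fun φ : AddMonoid.End _ => (E.idealSub U).mkQ (φ m)) (map_zero (E.act U))
  map_mul' A B := by
    refine AddMonoidHom.ext fun q => ?_
    obtain ⟨m, rfl⟩ := Submodule.Quotient.mk_surjective _ q
    exact congrArg (fun φ : AddMonoid.End _ => (E.idealSub U).mkQ (φ m)) (map_mul (E.act U) A B)
  map_add' A B := by
    refine AddMonoidHom.ext fun q => ?_
    obtain ⟨m, rfl⟩ := Submodule.Quotient.mk_surjective _ q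
    exact congrArg (fun φ : AddMonoid.End _ => (E.idealSub U).mkQ (φ m)) (map_add (E.act U) A B)

/-- Restriction of sections of `E / I_S E`. -/
def quotRes {U V : P.X.affineOpens} (h : V ≤ U) :
    (Γ(E.sheaf, U) ⧸ E.idealSub U) →+ (Γ(E.sheaf, V) ⧸ E.idealSub V) :=
  QuotientAddGroup.map (E.idealSub U).toAddSubgroup (E.idealSub V).toAddSubgroup
    (E.resSec h) (fun m hm => E.res_mem h m hm)

lemma quotRes_smul {U V : P.X.affineOpens} (h : V ≤ U) (f : Γ(P.X, U))
    (q : Γ(E.sheaf, U) ⧸ E.idealSub U) :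
    E.quotRes h (f • q) = resO P h f • E.quotRes h q := by
  obtain ⟨m, rfl⟩ := Submodule.Quotient.mk_surjective _ q
  exact congrArg (E.idealSub V).mkQ (E.resSec_smul h f m)

lemma quotAct_fn (U : P.X.affineOpens) (f : Γ(P.X, U)) (q : Γ(E.sheaf, U) ⧸ E.idealSub U) :
    E.quotAct U (fnOp P U f) q = f • q := by
  obtain ⟨m, rfl⟩ := Submodule.Quotient.mk_surjective _ q
  exact congrArg (E.idealSub U).mkQ (E.act_fn U f m)

lemma quotAct_res {U V : P.X.affineOpens} (h : V ≤ U) (D : logDiff P U) (Q : logDiff P V)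
    (hDQ : IsRes P h D Q) (q : Γ(E.sheaf, U) ⧸ E.idealSub U) :
    E.quotRes h (E.quotAct U D q) = E.quotAct V Q (E.quotRes h q) := by
  obtain ⟨m, rfl⟩ := Submodule.Quotient.mk_surjective _ q
  exact congrArg (E.idealSub V).mkQ (E.act_res h D Q hDQ m)

/-- The `D_X[log S]`-module `E|S = E / I_S E`; on affine opens its sections are the quotients
`Γ(E, U) / I_S(U) Γ(E, U)`. -/
def restrictS : DMod P where
  obj U := Γ(E.sheaf, U) ⧸ E.idealSub U
  res h := E.quotRes h
  res_smul h f q := E.quotRes_smul h f q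
  act := E.quotActHom
  act_fn := E.quotAct_fn
  act_res h D Q hDQ q := E.quotAct_res h D Q hDQ q

/-- Torsion-free as a module over functions, that is, a logarithmic connection. -/
def IsConnection : Prop :=
  ∀ (U : P.X.affineOpens) (f : Γ(P.X, U)) (m : Γ(E.sheaf, U)), f ≠ 0 → f • m = 0 → m = 0

/-- Supported on the reduced scheme `S`. -/
def IsSupportedOnS : Prop :=
  ∀ (U : P.X.affineOpens), ∀ f ∈ P.S.ideal U, ∀ m : Γ(E.sheaf, U), f • m = 0

/-- The sections of a subsheaf, as sections of `E`. -/
def secs (F : Subobject E.sheaf) (U : P.X.affineOpens) : Set Γ(E.sheaf, U) :=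
  Set.range (F.arrow.app U.1).hom

/-- The image of `F|S` in `E|S`. -/
def secsS (F : Subobject E.sheaf) (U : P.X.affineOpens) : Set (E.restrictS.obj U) :=
  (E.idealSub U).mkQ '' E.secs F U

/-- Stable under `D_X[log S]`. -/
def IsDSub (F : Subobject E.sheaf) : Prop :=
  ∀ (U : P.X.affineOpens) (D : logDiff P U), ∀ m ∈ E.secs F U, E.act U D m ∈ E.secs F U

/-- Semistability: pure dimensional, and `p(F') / r(F') ≤ p(E) / r(E)` for large arguments, for
each nonzero coherent `D_X[log S]`-submodule `F'`. -/
def IsSemistable : Prop :=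
  IsPure E.sheaf ∧ ∀ F : Subobject E.sheaf, IsCoherent (F : P.X.Modules) → E.IsDSub F → F ≠ ⊥ →
    ∀ᶠ n : ℕ in atTop, (normHilbertPoly P.str P.L (F : P.X.Modules)).eval (n : ℚ) ≤
      (normHilbertPoly P.str P.L E.sheaf).eval (n : ℚ)

/-- A vector subbundle of (the bundle on `X`) `E` that is a `D_X[log S]`-submodule. -/
def IsSubbundle (F : Subobject E.sheaf) : Prop :=
  E.IsDSub F ∧ IsLocFree (cokernel F.arrow)

/-- For `E` supported on `S`: a vector subbundle of (the bundle on `S`) `E` that is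
a `D_X[log S]`-submodule. -/
def IsSubbundleS (F : Subobject E.sheaf) : Prop :=
  E.IsDSub F ∧
    IsLocFree ((Scheme.Modules.pullback P.S.subschemeι).obj (cokernel F.arrow))

/-- `F`, if nonzero, has the normalized Hilbert polynomial of `E`. -/
def IsSpecial (F : Subobject E.sheaf) : Prop :=
  F ≠ ⊥ → normHilbertPoly P.str P.L (F : P.X.Modules) = normHilbertPoly P.str P.L E.sheaf

/-- Neither zero nor everything. -/
def IsProperSub (F : Subobject E.sheaf) : Prop := F ≠ ⊥ ∧ F ≠ ⊤

end LogModule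

/-! ### Reduced modules -/

/-- `Hom_Λ(M, N)`, where `Λ = D_X[log S]`. -/
def HomD (M N : DMod P) : Submodule ℂ (∀ U : P.X.affineOpens, M.obj U →ₗ[Γ(P.X, U)] N.obj U) where
  carrier := {φ | (∀ {U V : P.X.affineOpens} (h : V ≤ U) (m : M.obj U),
      φ V (M.res h m) = N.res h (φ U m)) ∧
    ∀ U (D : logDiff P U) (m : M.obj U), φ U (M.act U D m) = N.act U D (φ U m)}
  zero_mem' := by
    refine ⟨fun h m => ?_, fun U D m => ?_⟩ <;> simp
  add_mem' := by
    rintro φ ψ ⟨h1, h2⟩ ⟨h3, h4⟩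
    refine ⟨fun h m => ?_, fun U D m => ?_⟩
    · simp [h1 h, h3 h]
    · simp [h2, h4]
  smul_mem' := by
    rintro c φ ⟨h1, h2⟩
    refine ⟨fun h m => ?_, fun U D m => ?_⟩
    · exact (congrArg (c • ·) (h1 h m)).trans (DMod.res_smulC _ N h c _).symm
    · exact (congrArg (c • ·) (h2 U D m)).trans (DMod.act_smulC _ N U D c _).symm

/-- Eulerian vector fields on `U`: those inducing the section `θ` of
`D_X[log S] / I_S D_X[log S]`, such as `x ∂ / ∂ x` for a local equation `x` of `S`. -/
def IsEuler (U : P.X.affineOpens) (δ : Derivation ℂ Γ(P.X, U) Γ(P.X, U)) : Prop :=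
  (∀ f, δ f ∈ P.S.ideal U) ∧ ∀ f ∈ P.S.ideal U, δ f - f ∈ P.S.ideal U ^ 2

lemma IsEuler.isLogField {U : P.X.affineOpens} {δ : Derivation ℂ Γ(P.X, U) Γ(P.X, U)}
    (h : IsEuler U δ) : IsLogField P U δ := fun f _ => h.1 f

/-- `(E₀, E₁, s, t)` is a pre-`D`-module: `s t = θ` on `E₀|S` and `t s = θ` on `E₁`, the other
requirements being part of the types and of the first two conditions. -/
structure IsPreDModule (E₀ E₁ : LogModule P) (s : HomD E₁.toDMod E₀.restrictS)
    (t : HomD E₀.restrictS E₁.toDMod) : Prop where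
  connection : E₀.IsConnection
  supported : E₁.IsSupportedOnS
  st : ∀ U δ (h : IsEuler U δ) (q : E₀.restrictS.obj U),
    s.1 U (t.1 U q) = E₀.restrictS.act U (fieldOp P U δ h.isLogField) q
  ts : ∀ U δ (h : IsEuler U δ) (m : E₁.toDMod.obj U),
    t.1 U (s.1 U m) = E₁.toDMod.act U (fieldOp P U δ h.isLogField) m

variable (P) in
/-- A reduced module `(E₀, E₁, u)`: there are `s`, `t` such that `u = s ⊗ t` and
`(E₀, E₁, s, t)` is a pre-`D`-module. -/
structure ReducedModule where
  E₀ : LogModule P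
  E₁ : LogModule P
  u : HomD E₁.toDMod E₀.restrictS ⊗[ℂ] HomD E₀.restrictS E₁.toDMod
  exists_preD : ∃ s t, IsPreDModule E₀ E₁ s t ∧ u = s ⊗ₜ[ℂ] t

namespace ReducedModule

variable (E : ReducedModule P)

/-- A reduced module is semistable if it is associated to a semistable pre-`D`-module, that is,
one with `E₀` and `E₁` semistable. -/
def IsSemistable : Prop :=
  E.E₀.IsSemistable ∧ E.E₁.IsSemistable

/-- `u = s ⊗ t`, where `s = 0` and `t = 0` if `u = 0`. -/
def IsRep (s : HomD E.E₁.toDMod E.E₀.restrictS) (t : HomD E.E₀.restrictS E.E₁.toDMod) : Prop :=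
  E.u = s ⊗ₜ[ℂ] t ∧ (E.u = 0 → s = 0 ∧ t = 0)

variable {E}

/-- `s(G) ⊂ F|S`, for `G ⊂ E₁` and `F ⊂ E₀`. -/
def SMaps (s : HomD E.E₁.toDMod E.E₀.restrictS) (G : Subobject E.E₁.sheaf)
    (F : Subobject E.E₀.sheaf) : Prop :=
  ∀ U, ∀ m ∈ E.E₁.secs G U, s.1 U m ∈ E.E₀.secsS F U

/-- `t(F|S) ⊂ G`, for `F ⊂ E₀` and `G ⊂ E₁`. -/
def TMaps (t : HomD E.E₀.restrictS E.E₁.toDMod) (F : Subobject E.E₀.sheaf)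
    (G : Subobject E.E₁.sheaf) : Prop :=
  ∀ U, ∀ q ∈ E.E₀.secsS F U, t.1 U q ∈ E.E₁.secs G U

variable (E)

/-- A special filtration of the reduced module `E`: exhaustive increasing filtrations, indexed by
`ℤ`, of `E₀` and `E₁` by subbundles that are `D_X[log S]`-submodules, such that `s` and `t` are
filtered and all nonzero steps in `Eᵢ` have the normalized Hilbert polynomial of `Eᵢ`. -/
structure IsSpecialFiltration (F : ℤ → Subobject E.E₀.sheaf) (G : ℤ → Subobject E.E₁.sheaf) :
    Prop where
  mono₀ : Monotone F
  mono₁ : Monotone G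
  bot₀ : ∀ᶠ p in atBot, F p = ⊥
  bot₁ : ∀ᶠ p in atBot, G p = ⊥
  top₀ : ∀ᶠ p in atTop, F p = ⊤
  top₁ : ∀ᶠ p in atTop, G p = ⊤
  sub₀ : ∀ p, E.E₀.IsSubbundle (F p)
  sub₁ : ∀ p, E.E₁.IsSubbundleS (G p)
  filtered : ∃ s t, E.IsRep s t ∧ (∀ p, SMaps s (G p) (F p)) ∧ ∀ p, TMaps t (F p) (G p)
  special₀ : ∀ p, E.E₀.IsSpecial (F p)
  special₁ : ∀ p, E.E₁.IsSpecial (G p)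

/-- A reduced module is stable if it is semistable and has no nontrivial special filtration. -/
def IsStable : Prop :=
  E.IsSemistable ∧ ∀ F G, E.IsSpecialFiltration F G →
    ¬ ((∃ p, E.E₀.IsProperSub (F p)) ∨ ∃ p, E.E₁.IsProperSub (G p))

end ReducedModule

/-! ### Finite filtrations with proper inclusions, and compatibility -/

namespace LogModule

/-- `0 = F_0 ⊊ F_1 ⊊ ⋯ ⊊ F_l = E`, where all `F_j` satisfy `sub` and, if nonzero, have the normalized
Hilbert polynomial of `E`. -/
structure IsSpecialFlag (E : LogModule P) (sub : Subobject E.sheaf → Prop) {l : ℕ}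
    (F : Fin (l + 1) → Subobject E.sheaf) : Prop where
  strictMono : StrictMono F
  zero : F 0 = ⊥
  last : F (Fin.last l) = ⊤
  sub : ∀ j, sub (F j)
  special : ∀ j, E.IsSpecial (F j)

end LogModule

namespace ReducedModule

variable {E : ReducedModule P} {l₀ l₁ : ℕ}

/-- `k(j)`: the smallest `k` with `t(F_j|S) ⊂ G_k`. -/
def kOf (t : HomD E.E₀.restrictS E.E₁.toDMod) (F : Fin (l₀ + 1) → Subobject E.E₀.sheaf)
    (G : Fin (l₁ + 1) → Subobject E.E₁.sheaf) (j : Fin (l₀ + 1)) : Fin (l₁ + 1) :=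
  sInf {k | TMaps t (F j) (G k)}

/-- `j(k)`: the smallest `j` with `s(G_k) ⊂ F_j|S`. -/
def jOf (s : HomD E.E₁.toDMod E.E₀.restrictS) (F : Fin (l₀ + 1) → Subobject E.E₀.sheaf)
    (G : Fin (l₁ + 1) → Subobject E.E₁.sheaf) (k : Fin (l₁ + 1)) : Fin (l₀ + 1) :=
  sInf {j | SMaps s (G k) (F j)}

/-- `a` is a jump of `f`: `f(a - 1) < f(a)`; the index `0` counts as a jump. -/
def IsJump {a b : ℕ} (f : Fin (a + 1) → Fin (b + 1)) (x : Fin (a + 1)) : Prop :=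
  ∀ y : Fin (a + 1), y.val + 1 = x.val → f y < f x

/-- The region `{(x, y) | y ≤ f(x)}` under the graph of `f`. -/
def underGraph {a b : ℕ} (f : Fin (a + 1) → Fin (b + 1)) : Set (Fin (a + 1) × Fin (b + 1)) :=
  {x | x.2 ≤ f x.1}

/-- The region `{(x, y) | x ≤ g(y)}` to the left of the graph of `g`. -/
def leftOfGraph {a b : ℕ} (g : Fin (b + 1) → Fin (a + 1)) : Set (Fin (a + 1) × Fin (b + 1)) :=
  {x | x.1 ≤ g x.2}

/-- The regions under the graph of `k` and to the left of the graph of `j` meet only in points that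
are jump points of both graphs. -/
def MeetInJumps {a b : ℕ} (k : Fin (a + 1) → Fin (b + 1)) (j : Fin (b + 1) → Fin (a + 1)) : Prop :=
  ∀ x ∈ underGraph k ∩ leftOfGraph j,
    (x.2 = k x.1 ∧ IsJump k x.1) ∧ (x.1 = j x.2 ∧ IsJump j x.2)

variable (E)

/-- `u = s ⊗ t` is compatible with the filtrations `F` of `E₀` and `G` of `E₁`. -/
def IsCompatible (F : Fin (l₀ + 1) → Subobject E.E₀.sheaf)
    (G : Fin (l₁ + 1) → Subobject E.E₁.sheaf) : Prop :=
  ∃ s t, E.IsRep s t ∧ MeetInJumps (kOf t F G) (jOf s F G)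

end ReducedModule

end PreDMod

end

/-! Both conditions amount to the existence of weights. Attach to the steps of the two flags
strictly increasing integers `a` and `b`; then `s` and `t` respect the resulting `ℤ`-filtrations
exactly when `b (k x) ≤ a x` and `a (j y) ≤ b y`. Given such weights, a point `(x, y)` with `y ≤ k
x` and `x ≤ j y` yields the cycle `b y ≤ b (k x) ≤ a x ≤ a (j y) ≤ b y`. All terms are equal, the
point lies on both graphs, and strictness of the weights makes it a jump of both
(`meetInJumps_of_weights`). Conversely, compatibility forces `j (k x) ≤ x` and `k (j y) ≤ y`, and
then the weights `a x = x + k x`, `b y = y + j y` work. Subbundle and Hilbert polynomial conditions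
concern single steps, so they pass unchanged between a flag and its `ℤ`-filtration. -/

namespace PreDMod

/-! ### Order theory of weighted flags. -/

/-- The distinct steps of an exhaustive `ℤ`-indexed filtration, with the indices where they first
occur (counted from an index `p₀` before which the filtration vanishes). -/
lemma exists_jump_indices {α : Type*} [PartialOrder α] [OrderBot α] [OrderTop α] {F : ℤ → α}
    (hF : Monotone F) {p₀ : ℤ} (hbot : F p₀ = ⊥) (htop : ∀ᶠ p in atTop, F p = ⊤) :
    ∃ (l : ℕ) (c : Fin (l + 1) → ℤ), StrictMono c ∧ StrictMono (F ∘ c) ∧ F (c 0) = ⊥ ∧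
      F (c (Fin.last l)) = ⊤ ∧ (∀ j, p₀ ≤ c j) ∧ ∀ p, p₀ ≤ p → ∃ j, c j ≤ p ∧ F (c j) = F p := by
  classical
  obtain ⟨p₁, hp₁⟩ := eventually_atTop.1 htop
  -- The start `p₀` is included although it need not be a jump, so that the zero step receives an
  -- index.
  let A : Finset ℤ := (Finset.Icc p₀ (max p₀ p₁)).filter fun p => p = p₀ ∨ F (p - 1) ≠ F p
  have hmem : p₀ ∈ A := by simp [A]
  have hreach : ∀ p, p₀ ≤ p → ∃ q ∈ A, q ≤ p ∧ F q = F p := by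
    intro p hp
    induction p, hp using Int.leInduction with
    | base => exact ⟨p₀, hmem, le_rfl, rfl⟩
    | succ p hp ih =>
      by_cases h : F p = F (p + 1)
      · obtain ⟨q, hq, hqp, e⟩ := ih
        exact ⟨q, hq, by omega, e.trans h⟩
      · refine ⟨p + 1, ?_, le_rfl, rfl⟩
        -- From `p₁` on the filtration is constantly `⊤`, so every later jump lies in the finite
        -- window.
        have hlt : p < p₁ := by
          by_contra! hle
          exact h ((hp₁ p hle).trans (hp₁ (p + 1) (by omega)).symm)
        simp only [A, Finset.mem_filter, Finset.mem_Icc, add_sub_cancel_right]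
        exact ⟨⟨by omega, le_max_of_le_right (by omega)⟩, Or.inr h⟩
  obtain ⟨l, hl⟩ : ∃ l, A.card = l + 1 :=
    Nat.exists_eq_succ_of_ne_zero (Finset.card_ne_zero_of_mem hmem)
  let c := A.orderEmbOfFin hl
  have hcA : ∀ j, c j ∈ A := A.orderEmbOfFin_mem hl
  have hAc : ∀ q ∈ A, ∃ j, c j = q := fun q hq => by
    have : q ∈ Set.range c := by simpa [c] using hq
    exact this
  have hge : ∀ j, p₀ ≤ c j := fun j =>
    (Finset.mem_Icc.1 (Finset.mem_filter.1 (hcA j)).1).1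
  have hall : ∀ p, p₀ ≤ p → ∃ j, c j ≤ p ∧ F (c j) = F p := fun p hp => by
    obtain ⟨q, hq, hqp, e⟩ := hreach p hp
    obtain ⟨j, rfl⟩ := hAc q hq
    exact ⟨j, hqp, e⟩
  refine ⟨l, c, c.strictMono, fun i j hij => ?_, ?_, ?_, hge, hall⟩
  · have hlt : c i < c j := c.strictMono hij
    refine lt_of_le_of_ne (hF hlt.le) fun e => ?_
    -- Since `c i ≤ c j - 1`, equal values at `c i` and `c j` would also give `F (c j - 1) = F (c
    -- j)`, so `c j` would not be a jump.
    rcases (Finset.mem_filter.1 (hcA j)).2 with h | h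
    · exact absurd (hge i) (by omega)
    · exact h (le_antisymm (hF (by omega)) ((e.symm.le).trans (hF (by omega))))
  · obtain ⟨j, hj⟩ := hAc p₀ hmem
    exact le_bot_iff.1 ((hF (c.monotone (Fin.zero_le j))).trans (by rw [hj, hbot]))
  · obtain ⟨j, -, hj⟩ := hall (max p₀ p₁) (le_max_left _ _)
    rw [hp₁ _ (le_max_right _ _)] at hj
    exact top_le_iff.1 (hj.symm.le.trans (hF (c.monotone (Fin.le_last j))))

/-- Weights `a`, `b` that are not increased by `k` and `j` force the two regions to meet in jump
points only. -/
lemma ReducedModule.meetInJumps_of_weights {m n : ℕ} {k : Fin (m + 1) → Fin (n + 1)}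
    {j : Fin (n + 1) → Fin (m + 1)} {a : Fin (m + 1) → ℤ} {b : Fin (n + 1) → ℤ}
    (ha : StrictMono a) (hb : StrictMono b) (hk : ∀ x, b (k x) ≤ a x) (hj : ∀ y, a (j y) ≤ b y) :
    MeetInJumps k j := by
  rintro ⟨x, y⟩ ⟨h₁, h₂⟩
  change y ≤ k x at h₁
  change x ≤ j y at h₂
  have h₃ := hb.monotone h₁
  have h₄ := ha.monotone h₂
  have h₅ := hk x
  have h₆ := hj y
  -- The inequalities `h₃`, `h₅`, `h₄`, `h₆` close up into a cycle, hence are equalities.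
  have hy : y = k x := hb.injective (by omega)
  have hx : x = j y := ha.injective (by omega)
  refine ⟨⟨hy, fun z hz => ?_⟩, ⟨hx, fun z hz => ?_⟩⟩
  · change z.val + 1 = x.val at hz
    -- For the predecessor `z`: `b (k z) ≤ a z < a x = b (k x)`.
    have h₇ := ha (show z < x from Fin.lt_def.2 (by omega))
    have h₈ := hk z
    change k z < k x
    exact hb.lt_iff_lt.1 (by omega)
  · change z.val + 1 = y.val at hz
    have h₇ := hb (show z < y from Fin.lt_def.2 (by omega))
    have h₈ := hj z
    change j z < j y
    exact ha.lt_iff_lt.1 (by omega)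

/-- The `ℤ`-indexed filtration whose step at `p` is the largest `F j` of weight `a j ≤ p`. -/
lemma exists_filtration_of_weights {α : Type*} [PartialOrder α] [OrderBot α] [OrderTop α] {l : ℕ}
    {F : Fin (l + 1) → α} (hF : Monotone F) (hzero : F 0 = ⊥) (hlast : F (Fin.last l) = ⊤)
    {a : Fin (l + 1) → ℕ} (ha : StrictMono a) :
    ∃ F' : ℤ → α, Monotone F' ∧ (∀ᶠ p in atBot, F' p = ⊥) ∧ (∀ᶠ p in atTop, F' p = ⊤) ∧
      (∀ p, F' p = ⊥ ∨ ∃ j, (a j : ℤ) ≤ p ∧ F' p = F j) ∧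
      (∀ j (p : ℤ), a j ≤ p → F j ≤ F' p) ∧ ∀ j, F' (a j) = F j := by
  classical
  let T : ℤ → Finset (Fin (l + 1)) := fun p => Finset.univ.filter fun j => (a j : ℤ) ≤ p
  have hT : ∀ p j, j ∈ T p ↔ (a j : ℤ) ≤ p := fun p j => by simp [T]
  -- The supremum over an empty index set is `0`, so below all weights the value is `F 0 = ⊥`.
  let F' : ℤ → α := fun p => F ((T p).sup id)
  have hcase : ∀ p, F' p = ⊥ ∨ ∃ j, (a j : ℤ) ≤ p ∧ F' p = F j := fun p => by
    rcases (T p).eq_empty_or_nonempty with h | h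
    · left
      change F ((T p).sup id) = ⊥
      rw [h, Finset.sup_empty]
      exact hzero
    · obtain ⟨j, hj, e⟩ := Finset.exists_mem_eq_sup (T p) h id
      exact Or.inr ⟨j, (hT p j).1 hj, congrArg F e⟩
  have hle : ∀ j (p : ℤ), a j ≤ p → F j ≤ F' p := fun j p h =>
    hF (Finset.le_sup (f := id) ((hT p j).2 h))
  refine ⟨F', fun p q hpq => hF (Finset.sup_mono fun j hj => ?_), ?_, ?_, hcase, hle, fun j => ?_⟩
  · exact (hT q j).2 (((hT p j).1 hj).trans hpq)
  -- Weights are natural numbers, so no step has weight at most a negative `p`.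
  · filter_upwards [eventually_lt_atBot (0 : ℤ)] with p hp
    rcases hcase p with h | ⟨j, hj, -⟩
    · exact h
    · omega
  · filter_upwards [eventually_ge_atTop (a (Fin.last l) : ℤ)] with p hp
    exact top_le_iff.1 (hlast.symm.le.trans (hle _ p hp))
  · refine le_antisymm ?_ (hle j _ le_rfl)
    rcases hcase (a j) with h | ⟨i, hi, e⟩
    · rw [h]; exact bot_le
    · rw [e]; exact hF (ha.le_iff_le.1 (by exact_mod_cast hi))

/-! ### Sections of subsheaves and the maps between them. -/

variable {P : LogPair}

namespace LogModule

variable (E : LogModule P)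

lemma secs_mono {F G : Subobject E.sheaf} (h : F ≤ G) (U : P.X.affineOpens) :
    E.secs F U ⊆ E.secs G U := by
  rintro _ ⟨x, rfl⟩
  refine ⟨((Subobject.ofLE F G h).app U.1).hom x, ?_⟩
  rw [← Subobject.ofLE_arrow h]
  rfl

lemma secs_top (U : P.X.affineOpens) : E.secs ⊤ U = Set.univ := by
  refine Set.eq_univ_of_forall fun m => ?_
  refine ⟨((inv (⊤ : Subobject E.sheaf).arrow).app U.1).hom m, ?_⟩
  have h := congrArg (fun φ : E.sheaf ⟶ E.sheaf => (φ.app U.1).hom m)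
    (IsIso.inv_hom_id (⊤ : Subobject E.sheaf).arrow)
  exact h

lemma secsS_mono {F G : Subobject E.sheaf} (h : F ≤ G) (U : P.X.affineOpens) :
    E.secsS F U ⊆ E.secsS G U :=
  Set.image_mono (E.secs_mono h U)

lemma secsS_top (U : P.X.affineOpens) : E.secsS ⊤ U = Set.univ := by
  refine Set.eq_univ_of_forall fun q => ?_
  obtain ⟨m, rfl⟩ := Submodule.mkQ_surjective (E.idealSub U) q
  exact ⟨m, by rw [secs_top]; trivial, rfl⟩

end LogModule

namespace ReducedModule

variable {E : ReducedModule P}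

lemma SMaps.mono {s : HomD E.E₁.toDMod E.E₀.restrictS} {G G' : Subobject E.E₁.sheaf}
    {F F' : Subobject E.E₀.sheaf} (h : SMaps s G F) (hG : G' ≤ G) (hF : F ≤ F') : SMaps s G' F' :=
  fun U m hm => E.E₀.secsS_mono hF U (h U m (E.E₁.secs_mono hG U hm))

lemma TMaps.mono {t : HomD E.E₀.restrictS E.E₁.toDMod} {F F' : Subobject E.E₀.sheaf}
    {G G' : Subobject E.E₁.sheaf} (h : TMaps t F G) (hF : F' ≤ F) (hG : G ≤ G') : TMaps t F' G' :=
  fun U q hq => E.E₁.secs_mono hG U (h U q (E.E₀.secsS_mono hF U hq))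

lemma sMaps_top (s : HomD E.E₁.toDMod E.E₀.restrictS) (G : Subobject E.E₁.sheaf) :
    SMaps s G ⊤ := fun U m _ => by
  rw [E.E₀.secsS_top]; trivial

lemma tMaps_top (t : HomD E.E₀.restrictS E.E₁.toDMod) (F : Subobject E.E₀.sheaf) :
    TMaps t F ⊤ := fun U q _ => by
  rw [E.E₁.secs_top]; trivial

/-! ### The index functions `k(j)` and `j(k)`. -/

variable {l₀ l₁ : ℕ} {F : Fin (l₀ + 1) → Subobject E.E₀.sheaf}
  {G : Fin (l₁ + 1) → Subobject E.E₁.sheaf}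

lemma kOf_le {t : HomD E.E₀.restrictS E.E₁.toDMod} {j : Fin (l₀ + 1)} {k : Fin (l₁ + 1)}
    (h : TMaps t (F j) (G k)) : kOf t F G j ≤ k :=
  sInf_le h

lemma jOf_le {s : HomD E.E₁.toDMod E.E₀.restrictS} {j : Fin (l₀ + 1)} {k : Fin (l₁ + 1)}
    (h : SMaps s (G k) (F j)) : jOf s F G k ≤ j :=
  sInf_le h

/-- The defining minimum is attained: the last step is everything, so the set of admissible indices
is nonempty. -/
lemma tMaps_kOf (t : HomD E.E₀.restrictS E.E₁.toDMod) (hG : G (Fin.last l₁) = ⊤)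
    (j : Fin (l₀ + 1)) : TMaps t (F j) (G (kOf t F G j)) := by
  have hne : {k | TMaps t (F j) (G k)}.Nonempty :=
    ⟨Fin.last l₁, show TMaps t (F j) (G (Fin.last l₁)) by rw [hG]; exact tMaps_top t _⟩
  exact csInf_mem hne

lemma sMaps_jOf (s : HomD E.E₁.toDMod E.E₀.restrictS) (hF : F (Fin.last l₀) = ⊤)
    (k : Fin (l₁ + 1)) : SMaps s (G k) (F (jOf s F G k)) := by
  have hne : {j | SMaps s (G k) (F j)}.Nonempty :=
    ⟨Fin.last l₀, show SMaps s (G k) (F (Fin.last l₀)) by rw [hF]; exact sMaps_top s _⟩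
  exact csInf_mem hne

/-- Any step receiving the image of a larger subsheaf also receives that of a smaller one. This is
what makes the weights `j + k(j)` strictly increasing. -/
lemma kOf_mono (t : HomD E.E₀.restrictS E.E₁.toDMod) (hF : Monotone F)
    (hG : G (Fin.last l₁) = ⊤) : Monotone (kOf t F G) :=
  fun _ j hij => kOf_le ((tMaps_kOf t hG j).mono (hF hij) le_rfl)

lemma jOf_mono (s : HomD E.E₁.toDMod E.E₀.restrictS) (hG : Monotone G)
    (hF : F (Fin.last l₀) = ⊤) : Monotone (jOf s F G) :=
  fun _ k hij => jOf_le ((sMaps_jOf s hF k).mono (hG hij) le_rfl)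

/-! ### The two implications. -/

/-- The distinct steps of a nontrivial special filtration are flags with which `u` is
compatible. -/
lemma IsSpecialFiltration.exists_flags {F : ℤ → Subobject E.E₀.sheaf}
    {G : ℤ → Subobject E.E₁.sheaf} (h : E.IsSpecialFiltration F G)
    (hne : (∃ p, E.E₀.IsProperSub (F p)) ∨ ∃ p, E.E₁.IsProperSub (G p)) :
    ∃ (l₀ l₁ : ℕ) (F : Fin (l₀ + 1) → Subobject E.E₀.sheaf)
      (G : Fin (l₁ + 1) → Subobject E.E₁.sheaf),
      E.E₀.IsSpecialFlag E.E₀.IsSubbundle F ∧ E.E₁.IsSpecialFlag E.E₁.IsSubbundleS G ∧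
      ((∃ j, E.E₀.IsProperSub (F j)) ∨ ∃ k, E.E₁.IsProperSub (G k)) ∧ E.IsCompatible F G := by
  obtain ⟨s, t, hrep, hs, ht⟩ := h.filtered
  -- One `p₀` serves both filtrations, so that each index of one lies in the range where the other
  -- is described by its jumps.
  obtain ⟨p₀, hp₀⟩ := eventually_atBot.1 (h.bot₀.and h.bot₁)
  obtain ⟨l₀, a, ha, haF, ha0, hal, hage, haall⟩ :=
    exists_jump_indices h.mono₀ (hp₀ p₀ le_rfl).1 h.top₀
  obtain ⟨l₁, b, hb, hbG, hb0, hbl, hbge, hball⟩ :=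
    exists_jump_indices h.mono₁ (hp₀ p₀ le_rfl).2 h.top₁
  refine ⟨l₀, l₁, F ∘ a, G ∘ b, ⟨haF, ha0, hal, fun j => h.sub₀ _, fun j => h.special₀ _⟩,
    ⟨hbG, hb0, hbl, fun j => h.sub₁ _, fun j => h.special₁ _⟩, ?_, s, t, hrep,
    meetInJumps_of_weights ha hb (fun x => ?_) fun y => ?_⟩
  · refine hne.imp (fun ⟨p, hp⟩ => ?_) fun ⟨p, hp⟩ => ?_
    · have : p₀ ≤ p := le_of_not_ge fun hle => hp.1 (hp₀ p hle).1
      obtain ⟨j, -, hj⟩ := haall p this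
      exact ⟨j, by rw [Function.comp_apply, hj]; exact hp⟩
    · have : p₀ ≤ p := le_of_not_ge fun hle => hp.1 (hp₀ p hle).2
      obtain ⟨j, -, hj⟩ := hball p this
      exact ⟨j, by rw [Function.comp_apply, hj]; exact hp⟩
  -- At filtration index `a x`, `t` maps into `G (a x)`, which already occurs at some `b k ≤ a x`;
  -- hence `k(x) ≤ k`.
  · obtain ⟨k, hk, e⟩ := hball (a x) (hage x)
    have hle : kOf t (F ∘ a) (G ∘ b) x ≤ k := kOf_le ((ht (a x)).mono le_rfl e.symm.le)
    exact (hb.monotone hle).trans hk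
  · obtain ⟨j, hj, e⟩ := haall (b y) (hbge y)
    have hle : jOf s (F ∘ a) (G ∘ b) y ≤ j := jOf_le ((hs (b y)).mono le_rfl e.symm.le)
    exact (ha.monotone hle).trans hj

/-- Flags with which `u` is compatible are the steps of a special filtration: give the `j`-th step
of `E₀` the weight `j + k(j)` and the `k`-th step of `E₁` the weight `k + j(k)`. -/
lemma IsCompatible.exists_specialFiltration (hc : E.IsCompatible F G)
    (hF : E.E₀.IsSpecialFlag E.E₀.IsSubbundle F) (hG : E.E₁.IsSpecialFlag E.E₁.IsSubbundleS G) :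
    ∃ F' G', E.IsSpecialFiltration F' G' ∧ (∀ j, ∃ p, F' p = F j) ∧ ∀ k, ∃ p, G' p = G k := by
  obtain ⟨s, t, hrep, hm⟩ := hc
  have hFm := hF.strictMono.monotone
  have hGm := hG.strictMono.monotone
  -- The point `(j, k(j))` always lies in `G_t`. If `j < j(k(j))` it would also lie in `G_s` without
  -- being on the graph of `j(·)`. Only this half of compatibility is needed, not the jump
  -- condition.
  have hjk : ∀ j, jOf s F G (kOf t F G j) ≤ j := fun j => by
    by_contra! hlt
    exact hlt.ne (hm (j, kOf t F G j) ⟨le_refl (kOf t F G j), hlt.le⟩).2.1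
  have hkj : ∀ k, kOf t F G (jOf s F G k) ≤ k := fun k => by
    by_contra! hlt
    exact hlt.ne (hm (jOf s F G k, k) ⟨hlt.le, le_refl (jOf s F G k)⟩).1.1
  have ha : StrictMono fun j : Fin (l₀ + 1) => j.val + (kOf t F G j).val := fun i j hij =>
    add_lt_add_of_lt_of_le hij (kOf_mono t hFm hG.last hij.le)
  have hb : StrictMono fun k : Fin (l₁ + 1) => k.val + (jOf s F G k).val := fun i j hij =>
    add_lt_add_of_lt_of_le hij (jOf_mono s hGm hF.last hij.le)
  obtain ⟨F', hF'm, hF'b, hF't, hF'c, hF'l, hF'e⟩ :=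
    exists_filtration_of_weights hFm hF.zero hF.last ha
  obtain ⟨G', hG'm, hG'b, hG't, hG'c, hG'l, hG'e⟩ :=
    exists_filtration_of_weights hGm hG.zero hG.last hb
  have hF'F : ∀ p, ∃ j, F' p = F j := fun p =>
    (hF'c p).elim (fun h => ⟨0, h.trans hF.zero.symm⟩) fun ⟨j, _, h⟩ => ⟨j, h⟩
  have hG'G : ∀ p, ∃ j, G' p = G j := fun p =>
    (hG'c p).elim (fun h => ⟨0, h.trans hG.zero.symm⟩) fun ⟨j, _, h⟩ => ⟨j, h⟩
  -- Purely combinatorial: `k(0) ≤ k(j(0)) ≤ 0`.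
  have ht0 : kOf t F G 0 = 0 :=
    le_antisymm ((kOf_mono t hFm hG.last (Fin.zero_le _)).trans (hkj 0)) (Fin.zero_le _)
  have hs0 : jOf s F G 0 = 0 :=
    le_antisymm ((jOf_mono s hGm hF.last (Fin.zero_le _)).trans (hjk 0)) (Fin.zero_le _)
  refine ⟨F', G', ⟨hF'm, hG'm, hF'b, hG'b, hF't, hG't, fun p => ?_, fun p => ?_,
    ⟨s, t, hrep, fun p => ?_, fun p => ?_⟩, fun p => ?_, fun p => ?_⟩,
    fun j => ⟨_, hF'e j⟩, fun k => ⟨_, hG'e k⟩⟩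
  · obtain ⟨j, e⟩ := hF'F p
    rw [e]; exact hF.sub j
  · obtain ⟨j, e⟩ := hG'G p
    rw [e]; exact hG.sub j
  · rcases hG'c p with e | ⟨k, hk, e⟩
    · rw [e, ← hG.zero]
      refine (sMaps_jOf s hF.last 0).mono le_rfl ?_
      rw [hs0, hF.zero]; exact bot_le
    · rw [e]
      -- The target step `j(k)` has weight `j(k) + k(j(k)) ≤ j(k) + k`, the weight of step `k`,
      -- which is at most `p`.
      refine (sMaps_jOf s hF.last k).mono le_rfl (hF'l _ p (le_trans ?_ hk))
      have := Fin.le_def.1 (hkj k)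
      omega
  · rcases hF'c p with e | ⟨j, hj, e⟩
    · rw [e, ← hF.zero]
      refine (tMaps_kOf t hG.last 0).mono le_rfl ?_
      rw [ht0, hG.zero]; exact bot_le
    · rw [e]
      refine (tMaps_kOf t hG.last j).mono le_rfl (hG'l _ p (le_trans ?_ hj))
      have := Fin.le_def.1 (hjk j)
      omega
  · obtain ⟨j, e⟩ := hF'F p
    rw [e]; exact hF.special j
  · obtain ⟨j, e⟩ := hG'G p
    rw [e]; exact hG.special j

end ReducedModule

end PreDMod

theorem mainTheorem11 (P : PreDMod.LogPair) (E : PreDMod.ReducedModule P) (hE : E.IsSemistable) :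
    ¬ E.IsStable ↔
      ∃ (l₀ l₁ : ℕ) (F : Fin (l₀ + 1) → Subobject E.E₀.sheaf)
        (G : Fin (l₁ + 1) → Subobject E.E₁.sheaf),
        E.E₀.IsSpecialFlag E.E₀.IsSubbundle F ∧
        E.E₁.IsSpecialFlag E.E₁.IsSubbundleS G ∧
        ((∃ j, E.E₀.IsProperSub (F j)) ∨ ∃ k, E.E₁.IsProperSub (G k)) ∧
        E.IsCompatible F G := by
  constructor
  · intro hns
    by_contra hno
    exact hns ⟨hE, fun F G h hne => hno (h.exists_flags hne)⟩
  · rintro ⟨l₀, l₁, F, G, hF, hG, hne, hc⟩ hst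
    obtain ⟨F', G', h, hF', hG'⟩ := hc.exists_specialFiltration hF hG
    -- Every flag step occurs in the constructed filtration, so a proper step survives.
    refine hst.2 F' G' h (hne.imp (fun ⟨j, hj⟩ => ?_) fun ⟨k, hk⟩ => ?_)
    · obtain ⟨p, e⟩ := hF' j
      exact ⟨p, by rw [e]; exact hj⟩
    · obtain ⟨p, e⟩ := hG' k
      exact ⟨p, by rw [e]; exact hk⟩
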